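/- Let $\mathbb F_q$ be a finite field, $\mathbb F_{q^m}$ an extension of degree $m$, and let $\lambda,n,k,i\ge 0$ be integers with $\lambda<n$. A code of length $N$ is an $\mathbb F_{q^m}$-subspace of $\mathbb F_{q^m}^N$; a generator matrix of a code is a matrix over $\mathbb F_{q^m}$ whose rows span it. For a code $C$ put $C^{[j]}=\{(c_1^{q^j},\dots,c_N^{q^j}) : c\in C\}$ and $\Lambda_i(C)=C+C^{[1]}+\cdots+C^{[i]}$. The right stabiliser algebra of a code $C$ of length $N$ is $$\mathrm{Stab}_r(C)=\{M\in \mathcal M_N(\mathbb F_q) : cM\in C \text{ for all } c\in C\}.$$ A code of length $N$ and dimension $K$ splits if it has a generator matrix $\begin{pmatrix}G_1&0\\0&G_2\end{pmatrix}Q$ with $Q\in \mathrm{GL}_N(\mathbb F_q)$, where $G_1$ is an $a\times b$ matrix and $G_2$ a $(K-a)\times(N-b)$ matrix over $\mathbb F_{q^m}$, $0\le a\le K$ and $0<b<N$; otherwise it is indecomposable. A minimal decomposition of the identity into orthogonal idempotents of a matrix algebra $\mathcal A\subseteq\mathcal M_N(\mathbb F_q)$ is a tuple $F_1,\dots,F_r$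 of nonzero idempotents of $\mathcal A$ such that $F_sF_t=0$ for $s\ne t$, $F_1+\cdots+F_r=I_N$, and no $F_s$ is a sum of two nonzero orthogonal idempotents $e,f$ of $\mathcal A$ (orthogonal means $ef=fe=0$). Let $C_{\rm sec}$ be a code of length $n$ with generator matrix $G_{\rm sec}\in\mathcal M_{k,n}(\mathbb F_{q^m})$, let $X\in\mathcal M_{k,\lambda}(\mathbb F_{q^m})$ and $P\in \mathrm{GL}_{\lambda+n}(\mathbb F_q)$, and let $C_{\rm pub}$ be the code of length $\lambda+n$ with generator matrix $(X\mid G_{\rm sec})P$. Suppose that $\Lambda_i(C_{\rm pub})$ has a generator matrix of the form $$\begin{pmatrix}Y&0\\0&G_i\end{pmatrix}P,$$ where $Y$ is a matrix over $\mathbb F_{q^m}$ with $\lambda$ columns and $G_i$ is a generator matrix of $\Lambda_i(C_{\rm sec})$, and suppose that $\Lambda_i(C_{\rm sec})$ is indecomposable. Then every minimal decomposition of the identity into orthogonal idempotents of $\mathrm{Stab}_r(\Lambda_i(C_{\rm pub}))$ contains exactly one element $F$ of rank $n$. Moreover, there is a unit $A$ of the algebra $\mathrm{Stab}_r(\Lambda_i(C_{\rm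 pub}))$ such that $$F=A^{-1}E_2A,\qquad E_2=P^{-1}\begin{pmatrix}0&0\\0&I_n\end{pmatrix}P .$$ -/

import Mathlib

namespace RankCode

open Matrix

theorem exists_frob (K L : Type*) [Field K] [Field L] [Algebra K L] [Finite K] [Finite L] (j : ℕ) :
    ∃ φ : L →+* L, Function.Surjective φ ∧ ∀ x, φ x = x ^ (Nat.card K) ^ j := by
  have := Fintype.ofFinite K
  refine ⟨((FiniteField.frobeniusAlgHom K L) ^ j : L →ₐ[K] L).toRingHom,
    Finite.surjective_of_injective (RingHom.injective _), fun x => ?_⟩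
  change ((FiniteField.frobeniusAlgHom K L) ^ j : L →ₐ[K] L) x = _
  rw [AlgHom.coe_pow, FiniteField.coe_frobeniusAlgHom, pow_iterate, Nat.card_eq_fintype_card]

/-- The component-wise Frobenius image `C^{[j]} = {(c₁^{q^j}, …, c_n^{q^j}) ∣ c ∈ C}` of a code over
the finite extension `L` of `K = 𝔽_q`, where `q = Nat.card K`. It is an `L`-subspace because the
Frobenius map of the finite field `L` is an automorphism. -/
def frobPow (K : Type*) {L ι : Type*} [Field K] [Field L] [Algebra K L] [Finite K] [Finite L]
    (j : ℕ) (C : Submodule L (ι → L)) : Submodule L (ι → L) where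
  carrier := {x | ∃ c ∈ C, x = fun t => c t ^ (Nat.card K) ^ j}
  zero_mem' := by
    obtain ⟨φ, -, h⟩ := exists_frob K L j
    exact ⟨0, C.zero_mem, funext fun t => by simp [← h]⟩
  add_mem' := by
    rintro _ _ ⟨c, hc, rfl⟩ ⟨d, hd, rfl⟩
    obtain ⟨φ, -, h⟩ := exists_frob K L j
    exact ⟨c + d, C.add_mem hc hd, funext fun t => by simp [← h]⟩
  smul_mem' := by
    rintro a _ ⟨c, hc, rfl⟩
    obtain ⟨φ, hs, h⟩ := exists_frob K L j
    obtain ⟨b, rfl⟩ := hs a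
    exact ⟨b • c, C.smul_mem b hc, funext fun t => by simp [← h]⟩

/-- The `i`-th `q`-sum `Λ_i(C) = C + C^{[1]} + ⋯ + C^{[i]}`. -/
def qSum (K : Type*) {L ι : Type*} [Field K] [Field L] [Algebra K L] [Finite K] [Finite L]
    (i : ℕ) (C : Submodule L (ι → L)) : Submodule L (ι → L) :=
  ∑ j ∈ Finset.range (i + 1), frobPow K j C

/-- `G` is a generator matrix of the code `C`: its rows span `C`. -/
def IsGeneratorMatrix {L κ ι : Type*} [Field L] (G : Matrix κ ι L)
    (C : Submodule L (ι → L)) : Prop :=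
  Submodule.span L (Set.range G.row) = C

/-- A code of length `n` and dimension `k` splits if it has a generator matrix
`diag(G₁, G₂) Q` with `G₁` of size `a × b`, `G₂` of size `(k - a) × (n - b)`, both with at least one
column, and `Q ∈ GL_n(K)`. (A block may have no row; a block without column is not allowed,
since otherwise every code would split.) -/
def Splits (K : Type*) {L : Type*} [Field K] [Field L] [Algebra K L] {n : ℕ}
    (C : Submodule L (Fin n → L)) : Prop :=
  ∃ (a a' b b' : ℕ) (_ : a + a' = Module.finrank L C) (hb : b + b' = n)
    (G₁ : Matrix (Fin a) (Fin b) L) (G₂ : Matrix (Fin a') (Fin b') L)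
    (Q : GL (Fin n) K),
    0 < b ∧ 0 < b' ∧
    IsGeneratorMatrix
      (((fromBlocks G₁ 0 0 G₂).reindex (Equiv.refl _) (finSumFinEquiv.trans (finCongr hb))) *
        (Q : Matrix (Fin n) (Fin n) K).map (algebraMap K L)) C

/-- A code is indecomposable if it does not split. -/
def Indecomposable (K : Type*) {L : Type*} [Field K] [Field L] [Algebra K L] {n : ℕ}
    (C : Submodule L (Fin n → L)) : Prop :=
  ¬ Splits K C

/-- The right stabiliser algebra `{M ∈ M_ι(K) ∣ ∀ c ∈ C, c M ∈ C}` of a code `C ⊆ L^ι`. -/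
def rightStab (K : Type*) {L ι : Type*} [Field K] [Field L] [Algebra K L]
    [Fintype ι] [DecidableEq ι] (C : Submodule L (ι → L)) : Subalgebra K (Matrix ι ι K) where
  carrier := {M | ∀ c ∈ C, c ᵥ* M.map (algebraMap K L) ∈ C}
  mul_mem' := by
    intro M N hM hN c hc
    rw [Matrix.map_mul, ← vecMul_vecMul]
    exact hN _ (hM _ hc)
  add_mem' := by
    intro M N hM hN c hc
    rw [Matrix.map_add _ (map_add _), vecMul_add]
    exact C.add_mem (hM _ hc) (hN _ hc)
  algebraMap_mem' := by
    intro r c hc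
    have h : c ᵥ* ((algebraMap K (Matrix ι ι K) r).map (algebraMap K L)) = algebraMap K L r • c := by
      rw [Matrix.map_algebraMap r _ (map_zero _) rfl, Matrix.algebraMap_eq_diagonal]
      funext t
      simp [vecMul_diagonal, mul_comm]
    rw [h]
    exact C.smul_mem _ hc

/-- A minimal decomposition of the identity of the matrix algebra `A` into orthogonal idempotents:
nonzero idempotents `E₁, …, E_r` of `A` with `E_s E_t = 0` for `s ≠ t` and `E₁ + ⋯ + E_r = 1`, none
of which is a sum of two nonzero orthogonal idempotents of `A`. -/
structure IsMinimalDecomposition {K ι : Type*} [Field K] [Fintype ι] [DecidableEq ι]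
    (A : Subalgebra K (Matrix ι ι K)) {r : ℕ} (E : Fin r → A) : Prop where
  complete : CompleteOrthogonalIdempotents E
  ne_zero : ∀ s, E s ≠ 0
  minimal : ∀ s, ¬ ∃ e f : A, e ≠ 0 ∧ f ≠ 0 ∧ IsIdempotentElem e ∧ IsIdempotentElem f ∧
    e * f = 0 ∧ f * e = 0 ∧ E s = e + f

/-- The idempotent `E₂ = P⁻¹ diag(0, I_n) P`. -/
def idemTwo {K : Type*} [Field K] {lam n : ℕ} (P : GL (Fin lam ⊕ Fin n) K) :
    Matrix (Fin lam ⊕ Fin n) (Fin lam ⊕ Fin n) K :=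
  ((P⁻¹ : GL (Fin lam ⊕ Fin n) K) : Matrix (Fin lam ⊕ Fin n) (Fin lam ⊕ Fin n) K) *
    fromBlocks 0 0 0 1 * (P : Matrix (Fin lam ⊕ Fin n) (Fin lam ⊕ Fin n) K)

end RankCode

/-! This is a Krull–Schmidt argument. In the coordinates given by `P`, the code `Λ_i(C_pub)` is a
direct sum `D₁ ⊕ D₂` with `D₂ = Λ_i(C_sec)`, so `e = idemTwo P` lies in its stabiliser `A`, and the
corner `e A e` is a copy of the stabiliser of `D₂`. A nontrivial idempotent there would split `D₂`
(`splits_of_isIdempotentElem`); a finite ring with only trivial idempotents is local.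

The lower right blocks of the `E s` sum to `1`, so by locality one of them is a unit, i.e. `e * E s
* e` is invertible in the corner. Since `E s` is primitive, it is then conjugate to `e`
(`exists_units_conj_of_corner`), hence of rank `n`. Two orthogonal idempotents of rank `n` would
force `2n ≤ lam + n`, against `lam < n`. -/

namespace RankCode

open Matrix

/-! ### Idempotents and local rings among finite rings. -/

section FiniteRing

variable {R : Type*} [Ring R] [Finite R]

theorem exists_pow_isIdempotentElem (x : R) : ∃ m, 0 < m ∧ IsIdempotentElem (x ^ m) := by
  obtain ⟨a, b, hab, h⟩ : ∃ a b : ℕ, a < b ∧ x ^ a = x ^ b := by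
    obtain ⟨a, b, hne, h⟩ := Finite.exists_ne_map_eq_of_infinite (fun m : ℕ => x ^ m)
    rcases lt_or_gt_of_ne hne with hl | hl
    · exact ⟨a, b, hl, h⟩
    · exact ⟨b, a, hl, h.symm⟩
  obtain ⟨p, rfl⟩ := Nat.exists_eq_add_of_lt hab
  have step : ∀ c, a ≤ c → ∀ j, x ^ (c + (p + 1) * j) = x ^ c := by
    intro c hc j
    induction j with
    | zero => simp
    | succ j ih =>
      obtain ⟨d, rfl⟩ := Nat.exists_eq_add_of_le hc
      calc x ^ (a + d + (p + 1) * (j + 1))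
          = x ^ (a + p + 1) * x ^ (d + (p + 1) * j) := by rw [← pow_add]; congr 1; ring
        _ = x ^ (a + d + (p + 1) * j) := by rw [← h, ← pow_add]; congr 1; ring
        _ = _ := ih
  -- From exponent `a` on, the powers of `x` have period `p + 1`. This exponent is a multiple of the
  -- period and at least `a`, so doubling it changes nothing.
  refine ⟨(p + 1) * (a + 1), by positivity, ?_⟩
  change x ^ _ * x ^ _ = x ^ _
  rw [← pow_add]
  exact step _ (by nlinarith) _

theorem isNilpotent_or_isUnit (h : ∀ e : R, IsIdempotentElem e → e = 0 ∨ e = 1) (x : R) :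
    IsNilpotent x ∨ IsUnit x := by
  obtain ⟨m, hm, hx⟩ := exists_pow_isIdempotentElem x
  rcases h _ hx with h0 | h1
  · exact Or.inl ⟨m, h0⟩
  · exact Or.inr (IsUnit.of_pow_eq_one h1 hm.ne')

theorem exists_isUnit_of_isUnit_sum [Nontrivial R]
    (h : ∀ e : R, IsIdempotentElem e → e = 0 ∨ e = 1) {ι : Type*} (s : Finset ι) (f : ι → R)
    (hs : IsUnit (∑ t ∈ s, f t)) : ∃ t ∈ s, IsUnit (f t) := by
  have : IsLocalRing R := .of_isUnit_or_isUnit_one_sub_self fun a =>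
    (isNilpotent_or_isUnit h a).symm.imp_right fun ha => ha.isUnit_one_sub
  classical
  induction s using Finset.induction_on with
  | empty => simp at hs
  | insert t s ht ih =>
    rw [Finset.sum_insert ht] at hs
    obtain ⟨u, hu⟩ := hs
    have h1 : (↑u⁻¹ * f t) + ↑u⁻¹ * ∑ t ∈ s, f t = 1 := by
      rw [← mul_add, ← hu, Units.inv_mul]
    rcases IsLocalRing.isUnit_or_isUnit_of_add_one h1 with h2 | h2
    · exact ⟨t, by simp, (Units.isUnit_units_mul _ _).1 h2⟩
    · obtain ⟨t, ht, h3⟩ := ih ((Units.isUnit_units_mul _ _).1 h2)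
      exact ⟨t, by simp [ht], h3⟩

/-- If `f` is a primitive idempotent and `e f e` is invertible in the corner ring of the idempotent
`e`, then `f` and `e` are conjugate. -/
theorem exists_units_conj_of_corner {e f v : R} (he : IsIdempotentElem e)
    (hf : IsIdempotentElem f) (he0 : e ≠ 0)
    (hmin : ¬ ∃ x y : R, x ≠ 0 ∧ y ≠ 0 ∧ IsIdempotentElem x ∧ IsIdempotentElem y ∧
      x * y = 0 ∧ y * x = 0 ∧ f = x + y)
    (hve : v * e = v) (hl : v * f * e = e) (hr : e * f * v = e) :
    ∃ A : Rˣ, f = ↑A⁻¹ * e * A := by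
  have he' : e * e = e := he
  have hf' : f * f = f := hf
  have hvfv : v * f * v = v := by
    calc v * f * v = v * (e * f * v) := by simp only [← mul_assoc, hve]
      _ = v := by rw [hr, hve]
  have hg : (f * v * f) * (f * v * f) = f * v * f := by
    calc (f * v * f) * (f * v * f) = f * (v * (f * f) * v) * f := by simp only [mul_assoc]
      _ = _ := by rw [hf', hvfv]
  have hfg : f * (f * v * f) = f * v * f := by simp only [← mul_assoc, hf']
  have hgf : (f * v * f) * f = f * v * f := by simp only [mul_assoc, hf']
  have hg0 : f * v * f ≠ 0 := by
    intro h0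
    apply he0
    calc e = v * f * e := hl.symm
      _ = v * (e * f * v) * f * e := by rw [hr, hve]
      _ = v * e * (f * v * f) * e := by simp only [mul_assoc]
      _ = 0 := by rw [h0]; simp
  -- Otherwise `f * v * f` and its complement in `f` would decompose the primitive `f`.
  have hfvf : f * v * f = f := by
    by_contra hne
    refine hmin ⟨f * v * f, f - f * v * f, hg0, sub_ne_zero.2 (Ne.symm hne), hg, ?_, ?_, ?_,
      by abel⟩
    · change (f - f * v * f) * (f - f * v * f) = f - f * v * f
      rw [sub_mul, mul_sub, mul_sub, hf', hfg, hgf, hg]; abel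
    · rw [mul_sub, hgf, hg, sub_self]
    · rw [sub_mul, hfg, hg, sub_self]
  -- The standard intertwiner: `e * A = e * f = A * f`. Only its invertibility remains; by
  -- finiteness, injectivity of left multiplication by `A` suffices.
  set A : R := e * f + (1 - e) * (1 - f) with hA
  have heA : e * A = e * f := by
    rw [hA, mul_add, ← mul_assoc, he', ← mul_assoc, mul_sub e 1 e, mul_one, he', sub_self, zero_mul,
      add_zero]
  have hAf : A * f = e * f := by
    rw [hA, add_mul, mul_assoc, mul_assoc, hf', sub_mul 1 f f, hf', one_mul, sub_self]; simp
  have hinj : Function.Injective (A * ·) := by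
    refine (injective_iff_map_eq_zero (AddMonoidHom.mulLeft A)).2 fun x hx => ?_
    replace hx : A * x = 0 := hx
    have h1 : e * f * x = 0 := by rw [← heA, mul_assoc, hx, mul_zero]
    have h2 : f * x = 0 := by
      calc f * x = f * (v * e) * f * x := by rw [hve, hfvf]
        _ = f * v * (e * f * x) := by simp only [mul_assoc]
        _ = 0 := by rw [h1, mul_zero]
    have h3 : x = e * x := by
      have : A * x = x - e * x := by
        rw [hA, add_mul, h1, mul_assoc, sub_mul 1 f x, h2]
        simp [sub_mul]
      rw [hx] at this
      exact (sub_eq_zero.1 this.symm)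
    calc x = v * f * e * x := by rw [hl, ← h3]
      _ = v * (f * (e * x)) := by simp only [mul_assoc]
      _ = 0 := by rw [← h3, h2, mul_zero]
  obtain ⟨B, hB⟩ := Finite.surjective_of_injective hinj 1
  have hB' : B * A = 1 := by
    apply hinj
    change A * (B * A) = A * 1
    rw [← mul_assoc, show A * B = 1 from hB, one_mul, mul_one]
  refine ⟨⟨A, B, hB, hB'⟩, ?_⟩
  change f = B * e * A
  rw [mul_assoc, heA, ← hAf, ← mul_assoc, hB', one_mul]

end FiniteRing

/-! ### Row spans of block diagonal matrices. -/

section Blocks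

variable {L : Type*} [Field L]

theorem span_range_row_mul {κ ι ι' : Type*} [Fintype ι] (G : Matrix κ ι L) (R : Matrix ι ι' L) :
    Submodule.span L (Set.range (G * R).row) =
      (Submodule.span L (Set.range G.row)).map R.vecMulLinear := by
  rw [Submodule.map_span, ← Set.range_comp]
  rfl

theorem mem_span_range_row_fromBlocks {κ₁ κ₂ ι₁ ι₂ : Type*} (G₁ : Matrix κ₁ ι₁ L)
    (G₂ : Matrix κ₂ ι₂ L) (d : ι₁ ⊕ ι₂ → L) :
    d ∈ Submodule.span L (Set.range (fromBlocks G₁ 0 0 G₂).row) ↔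
      d ∘ Sum.inl ∈ Submodule.span L (Set.range G₁.row) ∧
        d ∘ Sum.inr ∈ Submodule.span L (Set.range G₂.row) := by
  let f₁ : (ι₁ → L) →ₗ[L] (ι₁ ⊕ ι₂ → L) :=
    { toFun := fun x => Sum.elim x 0
      map_add' := fun x y => by ext (t | t) <;> simp
      map_smul' := fun x y => by ext (t | t) <;> simp }
  let f₂ : (ι₂ → L) →ₗ[L] (ι₁ ⊕ ι₂ → L) :=
    { toFun := fun x => Sum.elim 0 x
      map_add' := fun x y => by ext (t | t) <;> simp
      map_smul' := fun x y => by ext (t | t) <;> simp }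
  have h : Set.range (fromBlocks G₁ 0 0 G₂).row =
      f₁ '' Set.range G₁.row ∪ f₂ '' Set.range G₂.row := by
    rw [← Set.range_comp, ← Set.range_comp, ← Set.Sum.elim_range]
    congr 1
  rw [h, Submodule.span_union, ← Submodule.map_span, ← Submodule.map_span, Submodule.mem_sup]
  constructor
  · rintro ⟨_, ⟨x, hx, rfl⟩, _, ⟨y, hy, rfl⟩, rfl⟩
    have h1 : (f₁ x + f₂ y) ∘ Sum.inl = x := by ext t; simp [f₁, f₂]
    have h2 : (f₁ x + f₂ y) ∘ Sum.inr = y := by ext t; simp [f₁, f₂]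
    rw [h1, h2]
    exact ⟨hx, hy⟩
  · rintro ⟨h1, h2⟩
    refine ⟨_, ⟨_, h1, rfl⟩, _, ⟨_, h2, rfl⟩, ?_⟩
    ext (t | t) <;> simp [f₁, f₂]

theorem IsGeneratorMatrix.mem_fromBlocks_mul_iff {κ₁ κ₂ ι₁ ι₂ ι : Type*} [Fintype ι₁] [Fintype ι₂]
    {G₁ : Matrix κ₁ ι₁ L} {G₂ : Matrix κ₂ ι₂ L} {C₂ : Submodule L (ι₂ → L)}
    {R : Matrix (ι₁ ⊕ ι₂) ι L} {C : Submodule L (ι → L)}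
    (hG₂ : IsGeneratorMatrix G₂ C₂) (h : IsGeneratorMatrix (fromBlocks G₁ 0 0 G₂ * R) C)
    (c : ι → L) :
    c ∈ C ↔ ∃ d : ι₁ ⊕ ι₂ → L, d ∘ Sum.inl ∈ Submodule.span L (Set.range G₁.row) ∧
      d ∘ Sum.inr ∈ C₂ ∧ d ᵥ* R = c := by
  rw [← h, span_range_row_mul, Submodule.mem_map, ← show _ = C₂ from hG₂]
  simp only [mem_span_range_row_fromBlocks, and_assoc, vecMulLinear_apply]

end Blocks

/-! ### Idempotents of the stabiliser split the code. -/

section Split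

variable {K L : Type*} [Field K] [Field L] [Algebra K L]

/-- A matrix whose rows form a basis adapted to an idempotent matrix. -/
theorem exists_rows_of_isIdempotentElem {n : ℕ} {M : Matrix (Fin n) (Fin n) K}
    (hM : IsIdempotentElem M) (h0 : M ≠ 0) (h1 : M ≠ 1) :
    ∃ (b b' : ℕ) (hb : b + b' = n) (Q : Matrix (Fin b ⊕ Fin b') (Fin n) K),
      0 < b ∧ 0 < b' ∧
      IsUnit (Q.submatrix (finSumFinEquiv.trans (finCongr hb)).symm id) ∧
      Q * M = (fromBlocks 1 0 0 0 : Matrix (Fin b ⊕ Fin b') (Fin b ⊕ Fin b') K) * Q := by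
  set T := M.vecMulLinear with hT
  have hTT : ∀ x, T (T x) = T x := fun x => by
    simp only [hT, vecMulLinear_apply, vecMul_vecMul, hM.eq]
  have hc : IsCompl (LinearMap.range T) (LinearMap.ker T) :=
    LinearMap.IsIdempotentElem.isCompl (LinearMap.ext hTT)
  have hT0 : T ≠ 0 := fun h => h0 <| by
    ext i j
    have := congrFun (LinearMap.congr_fun h (Pi.single i 1)) j
    simpa [hT] using this
  have hker : LinearMap.ker T ≠ ⊥ := fun h => h1 <| by
    ext i j
    have := congrFun (LinearMap.ker_eq_bot.1 h (hTT (Pi.single i 1))) j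
    simpa [hT, Matrix.one_apply, Pi.single_apply, eq_comm] using this
  have hfin : Module.finrank K (LinearMap.range T) + Module.finrank K (LinearMap.ker T) = n := by
    rw [LinearMap.finrank_range_add_finrank_ker]; simp
  -- Row vectors decompose as image plus kernel of `x ↦ x M`; both are nonzero because `M ≠ 0` and
  -- `M ≠ 1`.
  let B := ((Module.finBasis K (LinearMap.range T)).prod
    (Module.finBasis K (LinearMap.ker T))).map (Submodule.prodEquivOfIsCompl _ _ hc)
  refine ⟨_, _, hfin, of fun t => B t, ?_, ?_, ?_, ?_⟩
  · exact Submodule.one_le_finrank_iff.2 fun h => hT0 (LinearMap.range_eq_bot.1 h)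
  · exact Submodule.one_le_finrank_iff.2 hker
  · rw [← linearIndependent_rows_iff_isUnit]
    exact B.linearIndependent.comp _ (Equiv.injective _)
  · have hrow : ∀ s, (B s) ᵥ* M = T (B s) := fun s => rfl
    ext (s | s) j
    · have : T (B (Sum.inl s)) = B (Sum.inl s) := by
        simp only [B, Module.Basis.map_apply]
        obtain ⟨y, hy⟩ := (Module.finBasis K (LinearMap.range T) s).2
        simp [← hy, hTT]
      have h2 := congrFun ((hrow (Sum.inl s)).trans this) j
      rw [Matrix.mul_apply, Matrix.mul_apply, Fintype.sum_sum_type]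
      simpa [Matrix.one_apply, vecMul, dotProduct] using h2
    · have : T (B (Sum.inr s)) = 0 := by
        simp [B, Module.Basis.map_apply]
      have h2 := congrFun ((hrow (Sum.inr s)).trans this) j
      rw [Matrix.mul_apply, Matrix.mul_apply, Fintype.sum_sum_type]
      simpa [vecMul, dotProduct] using h2

/-- In a basis over `K` adapted to `M`, stability under `M` means that `C` contains the first
component of each of its words, hence also the second. So `C` is the sum of its two slices `U₁` and
`U₂`, whose bases give the blocks `G₁` and `G₂`. -/
theorem splits_of_isIdempotentElem {n : ℕ} {C : Submodule L (Fin n → L)}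
    {M : Matrix (Fin n) (Fin n) K} (hMC : M ∈ rightStab K C)
    (hM : IsIdempotentElem M) (h0 : M ≠ 0) (h1 : M ≠ 1) : Splits K C := by
  obtain ⟨b, b', hb, Q, hb0, hb0', hQ, hQM⟩ := exists_rows_of_isIdempotentElem hM h0 h1
  set e := finSumFinEquiv.trans (finCongr hb) with he
  set R : Matrix (Fin b ⊕ Fin b') (Fin n) L := Q.map (algebraMap K L) with hR
  have hRu : IsUnit (R.submatrix e.symm id) := by
    have := hQ.map (algebraMap K L).mapMatrix
    exact this
  have hRinj : Function.Injective R.vecMulLinear := by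
    intro x y hxy
    have key : ∀ z : Fin b ⊕ Fin b' → L, (z ∘ e.symm) ᵥ* R.submatrix e.symm id = z ᵥ* R := by
      intro z
      ext j
      simp only [vecMul, dotProduct, submatrix_apply, Function.comp, id]
      exact Equiv.sum_comp e.symm fun t => z t * R t j
    have h2 := vecMul_injective_of_isUnit hRu ((key x).trans (hxy.trans (key y).symm))
    ext t
    simpa using congrFun h2 (e t)
  have hRsurj : Function.Surjective R.vecMulLinear :=
    (LinearMap.injective_iff_surjective_of_finrank_eq_finrank (by simp [hb])).1 hRinj
  have hRM : R * M.map (algebraMap K L) =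
      (fromBlocks 1 0 0 0 : Matrix (Fin b ⊕ Fin b') (Fin b ⊕ Fin b') L) * R := by
    have := congrArg (fun N : Matrix _ _ K => N.map (algebraMap K L)) hQM
    rw [Matrix.map_mul, Matrix.map_mul, fromBlocks_map, Matrix.map_one _ (map_zero _) (map_one _),
      Matrix.map_zero _ (map_zero _), Matrix.map_zero _ (map_zero _),
      Matrix.map_zero _ (map_zero _)] at this
    exact this
  let σ := LinearEquiv.sumArrowLequivProdArrow (Fin b) (Fin b') L L
  let ψ := LinearEquiv.ofBijective _ ⟨hRinj, hRsurj⟩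
  let Φ : ((Fin b → L) × (Fin b' → L)) ≃ₗ[L] (Fin n → L) := σ.symm.trans ψ
  have hΦ : ∀ x y, Φ (x, y) = Sum.elim x y ᵥ* R := fun x y => rfl
  let U₁ := C.comap (Φ.toLinearMap ∘ₗ LinearMap.inl L _ _)
  let U₂ := C.comap (Φ.toLinearMap ∘ₗ LinearMap.inr L _ _)
  have hU : ∀ x y, Φ (x, y) ∈ C ↔ x ∈ U₁ ∧ y ∈ U₂ := by
    intro x y
    have hadd : Φ (x, y) = Φ (x, 0) + Φ (0, y) := by rw [← map_add]; simp
    constructor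
    · intro h
      have h3 : Φ (x, 0) ∈ C := by
        have := hMC _ h
        rwa [hΦ, vecMul_vecMul, hRM, ← vecMul_vecMul, vecMul_fromBlocks, Sum.elim_comp_inl,
          Sum.elim_comp_inr, vecMul_one, vecMul_zero, vecMul_zero, vecMul_zero, add_zero, add_zero,
          ← hΦ] at this
      refine ⟨h3, ?_⟩
      rw [hadd] at h
      exact (Submodule.add_mem_iff_right _ h3).1 h
    · rintro ⟨hx, hy⟩
      rw [hadd]
      exact C.add_mem hx hy
  have hUC : (U₁.prod U₂).map Φ.toLinearMap = C := by
    ext c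
    obtain ⟨⟨x, y⟩, rfl⟩ := Φ.surjective c
    rw [hU]
    exact Φ.injective.mem_set_image
  have hdim : Module.finrank L U₁ + Module.finrank L U₂ = Module.finrank L C := by
    rw [← hUC, LinearEquiv.finrank_map_eq, ← Module.finrank_prod]
    exact LinearEquiv.finrank_eq
      { toFun := fun z => ⟨(z.1, z.2), z.1.2, z.2.2⟩
        invFun := fun z => (⟨z.1.1, z.2.1⟩, ⟨z.1.2, z.2.2⟩)
        map_add' := fun _ _ => rfl
        map_smul' := fun _ _ => rfl }
  have hspan : ∀ {m : ℕ} (U : Submodule L (Fin m → L)),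
      Submodule.span L (Set.range (of fun t => (Module.finBasis L U t : Fin m → L)).row) = U := by
    intro m U
    have := congrArg (Submodule.map U.subtype) (Module.finBasis L U).span_eq
    rwa [Submodule.map_span, ← Set.range_comp, Submodule.map_top, Submodule.range_subtype] at this
  refine ⟨_, _, b, b', hdim, hb, of fun t => (Module.finBasis L U₁ t : Fin b → L),
    of fun t => (Module.finBasis L U₂ t : Fin b' → L), hQ.unit, hb0, hb0', ?_⟩
  rw [← he]
  have hmat : ∀ G : Matrix (Fin (Module.finrank L U₁) ⊕ Fin (Module.finrank L U₂))
      (Fin b ⊕ Fin b') L, G.reindex (Equiv.refl _) e *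
        (hQ.unit : Matrix (Fin n) (Fin n) K).map (algebraMap K L) = G * R := by
    intro G
    ext s j
    simp only [mul_apply]
    exact Equiv.sum_comp e.symm fun t => G s t * R t j
  unfold IsGeneratorMatrix
  rw [hmat, span_range_row_mul]
  ext c
  rw [Submodule.mem_map]
  simp only [mem_span_range_row_fromBlocks, hspan]
  constructor
  · rintro ⟨d, ⟨hd1, hd2⟩, rfl⟩
    have := (hU _ _).2 ⟨hd1, hd2⟩
    rwa [hΦ, Sum.elim_comp_inl_inr] at this
  · intro hc
    obtain ⟨⟨x, y⟩, rfl⟩ := Φ.surjective c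
    exact ⟨Sum.elim x y, (hU _ _).1 hc, (hΦ x y).symm⟩

end Split

/-! ### The corner cut out by `idemTwo P`. -/

section Corner

variable {K L : Type*} [Field K] [Field L] [Algebra K L] {lam n : ℕ}

/-- The matrix `P⁻¹ diag(0, N) P`. -/
def cornerEmb (P : GL (Fin lam ⊕ Fin n) K) (N : Matrix (Fin n) (Fin n) K) :
    Matrix (Fin lam ⊕ Fin n) (Fin lam ⊕ Fin n) K :=
  (P⁻¹).val * fromBlocks 0 0 0 N * P.val

/-- The lower right block of `P M P⁻¹`. -/
def cornerBlock (P : GL (Fin lam ⊕ Fin n) K)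
    (M : Matrix (Fin lam ⊕ Fin n) (Fin lam ⊕ Fin n) K) : Matrix (Fin n) (Fin n) K :=
  (P.val * M * (P⁻¹).val).toBlocks₂₂

theorem cornerEmb_mul (P : GL (Fin lam ⊕ Fin n) K) (N N' : Matrix (Fin n) (Fin n) K) :
    cornerEmb P N * cornerEmb P N' = cornerEmb P (N * N') := by
  have h : P.val * (P⁻¹).val = 1 := P.mul_inv
  calc cornerEmb P N * cornerEmb P N'
      = (P⁻¹).val * fromBlocks 0 0 0 N * (P.val * (P⁻¹).val) * fromBlocks 0 0 0 N' * P.val := by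
        simp only [cornerEmb, Matrix.mul_assoc]
    _ = _ := by
        rw [h, Matrix.mul_one, Matrix.mul_assoc (P⁻¹).val, fromBlocks_multiply]
        simp [cornerEmb]

theorem idemTwo_mul_mul_idemTwo (P : GL (Fin lam ⊕ Fin n) K)
    (M : Matrix (Fin lam ⊕ Fin n) (Fin lam ⊕ Fin n) K) :
    idemTwo P * M * idemTwo P = cornerEmb P (cornerBlock P M) := by
  calc idemTwo P * M * idemTwo P
      = (P⁻¹).val * (fromBlocks 0 0 0 1 * (P.val * M * (P⁻¹).val) * fromBlocks 0 0 0 1) * P.val := by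
        simp only [idemTwo, Matrix.mul_assoc]
    _ = _ := by
        rw [← fromBlocks_toBlocks (P.val * M * (P⁻¹).val), fromBlocks_multiply, fromBlocks_multiply]
        simp [cornerEmb, cornerBlock]

theorem rank_idemTwo (P : GL (Fin lam ⊕ Fin n) K) : (idemTwo P).rank = n := by
  classical
  rw [idemTwo, rank_mul_eq_left_of_isUnit_det, rank_mul_eq_right_of_isUnit_det]
  · have : (fromBlocks 0 0 0 1 : Matrix (Fin lam ⊕ Fin n) (Fin lam ⊕ Fin n) K) =
        diagonal (Sum.elim 0 1) := by
      rw [← diagonal_one, ← diagonal_zero, fromBlocks_diagonal]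
      rfl
    rw [this, rank_diagonal, Fintype.card_subtype]
    have h2 : (Finset.univ.filter fun t : Fin lam ⊕ Fin n => (Sum.elim 0 1 : _ → K) t ≠ 0) =
        Finset.univ.map Function.Embedding.inr := by
      ext (t | t) <;> simp
    rw [h2]
    simp
  · exact (isUnit_iff_isUnit_det _).1 (P⁻¹).isUnit
  · exact (isUnit_iff_isUnit_det _).1 P.isUnit

variable {C : Submodule L (Fin lam ⊕ Fin n → L)} {D₁ : Submodule L (Fin lam → L)}
  {D₂ : Submodule L (Fin n → L)} {P : GL (Fin lam ⊕ Fin n) K}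

theorem map_mul_map_inv (P : GL (Fin lam ⊕ Fin n) K) :
    P.val.map (algebraMap K L) * (P⁻¹).val.map (algebraMap K L) = 1 := by
  rw [← Matrix.map_mul, P.mul_inv, Matrix.map_one _ (map_zero _) (map_one _)]

theorem cornerEmb_mem_rightStab
    (hC : ∀ c, c ∈ C ↔ ∃ d : Fin lam ⊕ Fin n → L, d ∘ Sum.inl ∈ D₁ ∧ d ∘ Sum.inr ∈ D₂ ∧
      d ᵥ* P.val.map (algebraMap K L) = c)
    {N : Matrix (Fin n) (Fin n) K} (hN : N ∈ rightStab K D₂) : cornerEmb P N ∈ rightStab K C := by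
  intro c hc
  obtain ⟨d, -, h2, rfl⟩ := (hC c).1 hc
  refine (hC _).2 ⟨Sum.elim 0 ((d ∘ Sum.inr) ᵥ* N.map (algebraMap K L)), ?_, ?_, ?_⟩
  · rw [Sum.elim_comp_inl]
    exact D₁.zero_mem
  · rw [Sum.elim_comp_inr]
    exact hN _ h2
  · rw [cornerEmb, Matrix.map_mul, Matrix.map_mul, vecMul_vecMul, ← Matrix.mul_assoc,
      ← Matrix.mul_assoc, map_mul_map_inv, Matrix.one_mul, ← vecMul_vecMul, fromBlocks_map,
      vecMul_fromBlocks]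
    simp

/-- Pad a word of `D₂` with zeros, apply `M`, and read off the last `n` coordinates. -/
theorem cornerBlock_mem_rightStab
    (hC : ∀ c, c ∈ C ↔ ∃ d : Fin lam ⊕ Fin n → L, d ∘ Sum.inl ∈ D₁ ∧ d ∘ Sum.inr ∈ D₂ ∧
      d ᵥ* P.val.map (algebraMap K L) = c)
    {M : Matrix (Fin lam ⊕ Fin n) (Fin lam ⊕ Fin n) K} (hM : M ∈ rightStab K C) :
    cornerBlock P M ∈ rightStab K D₂ := by
  intro c hc
  have h1 : Sum.elim (0 : Fin lam → L) c ᵥ* P.val.map (algebraMap K L) ∈ C :=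
    (hC _).2 ⟨_, by rw [Sum.elim_comp_inl]; exact D₁.zero_mem, by rwa [Sum.elim_comp_inr], rfl⟩
  obtain ⟨d, -, h2, h3⟩ := (hC _).1 (hM _ h1)
  have h4 : d = Sum.elim (0 : Fin lam → L) c ᵥ* (P.val * M * (P⁻¹).val).map (algebraMap K L) := by
    rw [Matrix.map_mul, Matrix.map_mul, ← vecMul_vecMul, ← vecMul_vecMul, ← h3, vecMul_vecMul,
      map_mul_map_inv, vecMul_one]
  have h5 : d ∘ Sum.inr = c ᵥ* (cornerBlock P M).map (algebraMap K L) := by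
    rw [h4, ← fromBlocks_toBlocks (P.val * M * (P⁻¹).val), fromBlocks_map, vecMul_fromBlocks]
    simp [cornerBlock]
  rwa [← h5]

/-- If `C = (D₁ ⊕ D₂) P` with `D₂` indecomposable of length `n > lam`, then a minimal decomposition
of the identity of the right stabiliser of `C` has exactly one element of rank `n`, and this element
is conjugate to `idemTwo P`. -/
theorem IsMinimalDecomposition.existsUnique_rank_eq [Finite K] (hlam : lam < n)
    (hC : ∀ c, c ∈ C ↔ ∃ d : Fin lam ⊕ Fin n → L, d ∘ Sum.inl ∈ D₁ ∧ d ∘ Sum.inr ∈ D₂ ∧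
      d ᵥ* P.val.map (algebraMap K L) = c)
    (hind : Indecomposable K D₂) {r : ℕ} {E : Fin r → rightStab K C}
    (hE : IsMinimalDecomposition (rightStab K C) E) :
    (∃! s : Fin r, (E s : Matrix (Fin lam ⊕ Fin n) (Fin lam ⊕ Fin n) K).rank = n) ∧
    ∀ s : Fin r, (E s : Matrix (Fin lam ⊕ Fin n) (Fin lam ⊕ Fin n) K).rank = n →
      ∃ A : (rightStab K C)ˣ, (E s : Matrix (Fin lam ⊕ Fin n) (Fin lam ⊕ Fin n) K) =
        ((A⁻¹ : (rightStab K C)ˣ) : rightStab K C) * idemTwo P *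
          ((A : rightStab K C) : Matrix (Fin lam ⊕ Fin n) (Fin lam ⊕ Fin n) K) := by
  classical
  have hn : 0 < n := by omega
  have : NeZero n := ⟨hn.ne'⟩
  have hlocal : ∀ e : rightStab K D₂, IsIdempotentElem e → e = 0 ∨ e = 1 := by
    intro e he
    by_contra! h
    exact hind (splits_of_isIdempotentElem e.2 (congrArg Subtype.val he)
      (fun h0 => h.1 (Subtype.ext h0)) (fun h1 => h.2 (Subtype.ext h1)))
  let β : rightStab K C → rightStab K D₂ := fun M =>
    ⟨cornerBlock P M.1, cornerBlock_mem_rightStab hC M.2⟩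
  let ε : rightStab K D₂ → rightStab K C := fun N =>
    ⟨cornerEmb P N.1, cornerEmb_mem_rightStab hC N.2⟩
  have hεmul : ∀ N N', ε N * ε N' = ε (N * N') := fun N N' =>
    Subtype.ext (cornerEmb_mul P _ _)
  have hεβ : ∀ M, ε 1 * M * ε 1 = ε (β M) := fun M =>
    Subtype.ext (idemTwo_mul_mul_idemTwo P _)
  have hε1 : (ε 1 : Matrix (Fin lam ⊕ Fin n) (Fin lam ⊕ Fin n) K) = idemTwo P := rfl
  -- Only additivity of `β` and `β 1 = 1` are needed here.
  have hsum : ∑ s, β (E s) = 1 := by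
    apply Subtype.ext
    have h1 : ∑ s, (E s : Matrix (Fin lam ⊕ Fin n) (Fin lam ⊕ Fin n) K) = 1 := by
      simpa using congrArg Subtype.val hE.complete.complete
    have h2 : ∑ s, cornerBlock P (E s) =
        cornerBlock P (∑ s, (E s : Matrix (Fin lam ⊕ Fin n) (Fin lam ⊕ Fin n) K)) := by
      ext x y
      simp [cornerBlock, Matrix.mul_sum, Matrix.sum_mul, Matrix.sum_apply,
        Matrix.toBlocks₂₂]
    have h3 : cornerBlock P 1 = 1 := by
      have : P.val * (P⁻¹).val = 1 := P.mul_inv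
      rw [cornerBlock, Matrix.mul_one, this, ← Matrix.fromBlocks_one,
        Matrix.toBlocks_fromBlocks₂₂]
    simpa [β, h1, h3] using h2
  obtain ⟨s, -, u, hu⟩ := exists_isUnit_of_isUnit_sum hlocal Finset.univ (fun s => β (E s))
    (hsum ▸ isUnit_one)
  replace hu : (u : rightStab K D₂) = β (E s) := hu
  have he0 : ε 1 ≠ 0 := by
    intro h
    have h1 := congrArg Matrix.rank (hε1.symm.trans (congrArg Subtype.val h))
    rw [rank_idemTwo] at h1
    simp at h1
    omega
  have hev : ε 1 * ε ↑u⁻¹ = ε ↑u⁻¹ := by rw [hεmul, one_mul]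
  have hve : ε ↑u⁻¹ * ε 1 = ε ↑u⁻¹ := by rw [hεmul, mul_one]
  -- `ε ↑u⁻¹` is the inverse of `ε 1 * E s * ε 1 = ε u` in the corner, whose identity is `ε 1`.
  obtain ⟨A, hA⟩ := exists_units_conj_of_corner (e := ε 1) (f := E s) (v := ε ↑u⁻¹)
    (by rw [IsIdempotentElem, hεmul, one_mul]) (hE.complete.idem s) he0 (hE.minimal s) hve
    (by rw [← hve, mul_assoc (ε _), mul_assoc (ε _), hεβ, ← hu, hεmul, Units.inv_mul])
    (by rw [← hev, ← mul_assoc, hεβ, ← hu, hεmul, Units.mul_inv])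
  have hA' := congrArg Subtype.val hA
  have hrank : (E s : Matrix (Fin lam ⊕ Fin n) (Fin lam ⊕ Fin n) K).rank = n := by
    have hdet : ∀ B : (rightStab K C)ˣ, IsUnit (B : rightStab K C).1.det :=
      fun B => (Matrix.isUnit_iff_isUnit_det _).1 (B.isUnit.map (rightStab K C).val)
    rw [hA']
    change (((A⁻¹ : (rightStab K C)ˣ) : rightStab K C).1 *
      idemTwo P * (A : rightStab K C).1).rank = n
    rw [Matrix.rank_mul_eq_left_of_isUnit_det _ _ (hdet A),
      Matrix.rank_mul_eq_right_of_isUnit_det _ _ (hdet A⁻¹), rank_idemTwo]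
  have huniq : ∀ t, (E t : Matrix (Fin lam ⊕ Fin n) (Fin lam ⊕ Fin n) K).rank = n → t = s := by
    intro t ht
    by_contra hne
    have h0 : (E t).1 * (E s).1 = 0 := congrArg Subtype.val (hE.complete.ortho hne)
    have h1 := Matrix.rank_add_rank_le_card_of_mul_eq_zero h0
    rw [ht, hrank] at h1
    simp at h1
    omega
  refine ⟨⟨s, hrank, huniq⟩, fun t ht => ?_⟩
  obtain rfl := huniq t ht
  exact ⟨A, hA'⟩

end Corner

end RankCode

theorem mainTheorem1 {K L : Type*} [Field K] [Finite K] [Field L] [Finite L] [Algebra K L]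
    {lam n k i : ℕ} (hlam : lam < n)
    (Csec : Submodule L (Fin n → L)) (Cpub : Submodule L (Fin lam ⊕ Fin n → L))
    (Gsec : Matrix (Fin k) (Fin n) L) (X : Matrix (Fin k) (Fin lam) L)
    (P : Matrix.GeneralLinearGroup (Fin lam ⊕ Fin n) K)
    (hsec : RankCode.IsGeneratorMatrix Gsec Csec)
    (hpub : RankCode.IsGeneratorMatrix
      (Matrix.fromCols X Gsec *
        (P : Matrix (Fin lam ⊕ Fin n) (Fin lam ⊕ Fin n) K).map (algebraMap K L)) Cpub)
    {a b : ℕ} (Y : Matrix (Fin a) (Fin lam) L) (Gi : Matrix (Fin b) (Fin n) L)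
    (hGi : RankCode.IsGeneratorMatrix Gi (RankCode.qSum K i Csec))
    (hshape : RankCode.IsGeneratorMatrix
      (Matrix.fromBlocks Y 0 0 Gi *
        (P : Matrix (Fin lam ⊕ Fin n) (Fin lam ⊕ Fin n) K).map (algebraMap K L))
      (RankCode.qSum K i Cpub))
    (hind : RankCode.Indecomposable K (RankCode.qSum K i Csec))
    {r : ℕ} (E : Fin r → RankCode.rightStab K (RankCode.qSum K i Cpub))
    (hE : RankCode.IsMinimalDecomposition (RankCode.rightStab K (RankCode.qSum K i Cpub)) E) :
    (∃! s : Fin r, (E s : Matrix (Fin lam ⊕ Fin n) (Fin lam ⊕ Fin n) K).rank = n) ∧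
    ∀ s : Fin r, (E s : Matrix (Fin lam ⊕ Fin n) (Fin lam ⊕ Fin n) K).rank = n →
      ∃ A : (RankCode.rightStab K (RankCode.qSum K i Cpub))ˣ,
        (E s : Matrix (Fin lam ⊕ Fin n) (Fin lam ⊕ Fin n) K) =
          ((A⁻¹ : (RankCode.rightStab K (RankCode.qSum K i Cpub))ˣ) :
            RankCode.rightStab K (RankCode.qSum K i Cpub)) * RankCode.idemTwo P *
          ((A : RankCode.rightStab K (RankCode.qSum K i Cpub)) :
            Matrix (Fin lam ⊕ Fin n) (Fin lam ⊕ Fin n) K) := by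
  -- Here `D₁` is the row span of `Y`.
  exact hE.existsUnique_rank_eq hlam (hGi.mem_fromBlocks_mul_iff hshape) hind
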